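/- Let $\tau=[0,1]$ and let $Y_1,Y_2,\dots$ be independent, identically distributed random elements of $L^2(\tau)$ (jointly measurable in $(\omega,t)$) with $E\,Y_i(t)=0$ and $E\|Y_i\|^2<\infty$, and with covariance kernel $c(t,s)=E[Y_1(t)Y_1(s)]$. Let $\mu_1,\mu_2\in L^2(\tau)$, $\Delta=\mu_1-\mu_2$, $\theta\in(0,1)$. For each sample size $N$ let $X_i=\mu_1+Y_i$ for $1\le i\le \lfloor N\theta\rfloor$ and $X_i=\mu_2+Y_i$ for $\lfloor N\theta\rfloor<i\le N$. For $u\in(0,1]$ and $k=\lfloor Nu\rfloor$ put $\widehat\mu_k=\frac1k\sum_{i=1}^kX_i$, $\widetilde\mu_k=\frac1{N-k}\sum_{i=k+1}^NX_i$ (a mean over an empty set of indices does not enter below) and $$\widehat c_u(t,s)=\frac1N\Big[\sum_{i=1}^{k}(X_i(t)-\widehat\mu_k(t))(X_i(s)-\widehat\mu_k(s))+\sum_{i=k+1}^{N}(X_i(t)-\widetilde\mu_k(t))(X_i(s)-\widetilde\mu_k(s))\Big],$$ $$c_u(t,s)=c(t,s)+\theta(1-\theta)f_\theta(u)\,\Delta(t)\Delta(s),\qquad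 f_\theta(u)=\frac{\max\{u,\theta\}-\min\{u,\theta\}}{\max\{u,\theta\}\,(1-\min\{u,\theta\})}.$$ Let $\gamma_u^1\ge\gamma_u^2\ge\cdots\ge 0$ be the eigenvalues, in decreasing order and repeated according to multiplicity (continued by zeros if only finitely many are nonzero), of the integral operator on $L^2(\tau)$ with kernel $c_u$, with orthonormal eigenfunctions $\omega_u^1,\omega_u^2,\dots$, and let $\widehat\lambda_u^1\ge\widehat\lambda_u^2\ge\cdots$ and $\widehat\upsilon_u^1,\widehat\upsilon_u^2,\dots$ be such eigenvalues and orthonormal eigenfunctions for the kernel $\widehat c_u$. Then for every $u\in(0,1]$ and every $l\ge1$, as $N\to\infty$, $$\widehat\lambda_u^l\xrightarrow{P}\gamma_u^l ,$$ and, if the eigenvalue $\gamma_u^l$ is simple (i.e. $\gamma_u^m\ne\gamma_u^l$ for all $m\ne l$; this holds for all $l\le d$ when $\gamma_u^1>\gamma_u^2>\dots>\gamma_u^d>\gamma_u^{d+1}$), $$\int_\tau\big[\widehat\upsilon_u^l(t)-\widehat c_u^{\,l}\,\omega_u^l(t)\big]^2dt\xrightarrow{P}0,\qquad \widehat c_u^{\,l}=\operatorname{sgn}\langle\omega_u^l,\widehat\upsilon_u^l\rangle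 .$$ -/

import Mathlib

open MeasureTheory ProbabilityTheory Filter Topology

noncomputable section

/-- The Hilbert space `L²([0,1])` with Lebesgue measure. -/
abbrev L2I : Type := Lp ℝ 2 (volume : Measure unitInterval)

/-- Random elements of `L²([0,1])` are taken with respect to its Borel σ-algebra. -/
instance instMeasurableSpaceL2I : MeasurableSpace L2I := borel L2I

instance instBorelSpaceL2I : BorelSpace L2I := ⟨rfl⟩

/-- The error functions `Y 0, Y 1, …` (the value of the `i`-th one at `t ∈ [0,1]` is `Y i ω t`):
jointly measurable, with paths in `L²([0,1])`, independent and identically distributed as random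
elements of `L²([0,1])`, centered, and with `E ‖Y i‖² < ∞`. -/
structure IsIIDNoise {Ω : Type*} [MeasurableSpace Ω] (P : Measure Ω)
    (Y : ℕ → Ω → unitInterval → ℝ) : Prop where
  measurable : ∀ i, Measurable (fun p : Ω × unitInterval => Y i p.1 p.2)
  path_memLp : ∀ i ω, MemLp (Y i ω) 2 volume
  indep : iIndepFun (fun (i : ℕ) (ω : Ω) => ((path_memLp i ω).toLp (Y i ω) : L2I)) P
  identDistrib : ∀ i,
    IdentDistrib (fun ω : Ω => ((path_memLp i ω).toLp (Y i ω) : L2I))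
      (fun ω : Ω => ((path_memLp 0 ω).toLp (Y 0 ω) : L2I)) P P
  mean_zero : ∀ i, ∀ᵐ t : unitInterval, ∫ ω, Y i ω t ∂P = 0
  second_moment : ∀ i, Integrable (fun ω => ∫ t : unitInterval, (Y i ω t) ^ 2) P

/-- The common covariance kernel `c(t,s) = E[Y(t) Y(s)]` of the errors. -/
def covKernel {Ω : Type*} [MeasurableSpace Ω] (P : Measure Ω)
    (Y : ℕ → Ω → unitInterval → ℝ) (t s : unitInterval) : ℝ :=
  ∫ ω, Y 0 ω t * Y 0 ω s ∂P

/-- The observations in a sample of size `N` with one change point: the mean is `μ₁` for the first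
`⌊N θ⌋` observations and `μ₂` for the others. The indices are `i = 0, …, N - 1`, so that
`changePointObs θ μ₁ μ₂ Y N i` is observation number `i + 1`. -/
def changePointObs {Ω : Type*} (θ : ℝ) (μ₁ μ₂ : unitInterval → ℝ)
    (Y : ℕ → Ω → unitInterval → ℝ) (N i : ℕ) (ω : Ω) (t : unitInterval) : ℝ :=
  (if i < ⌊(N : ℝ) * θ⌋₊ then μ₁ t else μ₂ t) + Y i ω t

/-- The mean of the first `k` functions of the sample `x`. -/
def meanBefore (x : ℕ → unitInterval → ℝ) (k : ℕ) (t : unitInterval) : ℝ :=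
  (1 / (k : ℝ)) * ∑ i ∈ Finset.range k, x i t

/-- The mean of the last `N - k` functions of the sample `x` of size `N`. -/
def meanAfter (x : ℕ → unitInterval → ℝ) (N k : ℕ) (t : unitInterval) : ℝ :=
  (1 / ((N : ℝ) - (k : ℝ))) * ∑ i ∈ Finset.Ico k N, x i t

/-- The estimator `ĉ_u(t,s)` of the covariance kernel from the sample `x` of size `N`, which is
split at `k = ⌊N u⌋`. For `u = 1` the second sum is empty and this is the usual estimator. -/
def empCovKernel (x : ℕ → unitInterval → ℝ) (N : ℕ) (u : ℝ) (t s : unitInterval) : ℝ :=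
  (1 / (N : ℝ)) *
    (∑ i ∈ Finset.range ⌊(N : ℝ) * u⌋₊,
        (x i t - meanBefore x ⌊(N : ℝ) * u⌋₊ t) * (x i s - meanBefore x ⌊(N : ℝ) * u⌋₊ s)
      + ∑ i ∈ Finset.Ico ⌊(N : ℝ) * u⌋₊ N,
        (x i t - meanAfter x N ⌊(N : ℝ) * u⌋₊ t) * (x i s - meanAfter x N ⌊(N : ℝ) * u⌋₊ s))

/-- The factor `f_θ(u)`. -/
def biasFactor (θ u : ℝ) : ℝ :=
  (max u θ - min u θ) / (max u θ * (1 - min u θ))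

/-- The kernel `c_u(t,s) = c(t,s) + θ (1 - θ) Δ(t) Δ(s) f_θ(u)` with `Δ = μ₁ - μ₂`. -/
def limitKernel {Ω : Type*} [MeasurableSpace Ω] (P : Measure Ω) (θ : ℝ)
    (μ₁ μ₂ : unitInterval → ℝ) (Y : ℕ → Ω → unitInterval → ℝ) (u : ℝ)
    (t s : unitInterval) : ℝ :=
  covKernel P Y t s + θ * (1 - θ) * (μ₁ t - μ₂ t) * (μ₁ s - μ₂ s) * biasFactor θ u

/-- `(lam l, v l)`, `l = 0, 1, …`, lists the eigenvalues of the integral operator with the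
positive semidefinite square-integrable kernel `κ` in decreasing order and with multiplicity,
together with orthonormal eigenfunctions: the operator vanishes on the orthogonal complement of
all `v l`, so that no nonzero eigenvalue is left out (if there are only finitely many nonzero
ones, the list goes on with zeros). -/
structure IsEigensystem (κ : unitInterval → unitInterval → ℝ) (lam : ℕ → ℝ) (v : ℕ → L2I) :
    Prop where
  antitone : Antitone lam
  orthonormal : Orthonormal ℝ v
  eigen : ∀ l, ∀ᵐ t : unitInterval, ∫ s, κ t s * v l s = lam l * v l t
  complete : ∀ x : L2I, (∀ l, inner ℝ (v l) x = 0) →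
    ∀ᵐ t : unitInterval, ∫ s, κ t s * x s = 0

end

/-! Everything is moved from kernels to bounded operators on `L2I`. Two ingredients suffice:
operator-norm convergence of the empirical covariance operator, and deterministic perturbation
bounds.

Convergence: centring identities write the empirical operator through the full average of `x i ⊗ x
i` and the normalized partial sums of `x i` (`splitCovariance_eq`). The strong law in Banach spaces,
applied to the noise and to its rank-one squares, gives almost sure limits. The deterministic part
that remains is the within-block variance of a two-valued step function split at `u`, a multiple of
`Δ ⊗ Δ` (`between_block_identity`, `tendsto_splitCovariance`).

Perturbation: Weyl's inequality bounds each eigenvalue error by `‖T - S‖` (`abs_sub_le_norm_sub`).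
At a simple eigenvalue with gap `δ`, a Davis–Kahan type bound controls the squared eigenvector error
by `8 / δ ^ 2 * ‖T - S‖ ^ 2` (`norm_eigenvector_sub_sq_le`). Both hold for every sample point, so
convergence in probability carries over. -/

/-- Spectral data of a positive operator: `(lam l, v l)` lists its eigenvalues in decreasing order
with orthonormal eigenvectors, and the operator vanishes on the complement of the `v l`. -/
structure IsSpectralSystem {H : Type*} [NormedAddCommGroup H] [InnerProductSpace ℝ H]
    (T : H →L[ℝ] H) (lam : ℕ → ℝ) (v : ℕ → H) : Prop where
  antitone : Antitone lam
  nonneg : ∀ l, 0 ≤ lam l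
  orthonormal : Orthonormal ℝ v
  symmetric : ∀ x y, inner ℝ (T x) y = inner ℝ x (T y)
  eigen : ∀ l, T (v l) = lam l • v l
  complete : ∀ x : H, (∀ l, inner ℝ (v l) x = 0) → T x = 0

/-! ### Perturbation of eigenvalues and eigenvectors -/

namespace IsSpectralSystem

variable {H : Type*} [NormedAddCommGroup H] [InnerProductSpace ℝ H] {T S : H →L[ℝ] H}
  {lam mu : ℕ → ℝ} {v w : ℕ → H}

/-- Vectors added when extending `v` to a Hilbert basis are orthogonal to every `v l`, so `complete`
makes `T` vanish on them. Thus `T` is diagonal without any appeal to a spectral theorem. -/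
theorem exists_hilbertBasis [CompleteSpace H] (h : IsSpectralSystem T lam v) :
    ∃ (s : Set H) (b : HilbertBasis s ℝ H) (β : s → ℝ), (∀ i, T (b i) = β i • b i) ∧
      (∀ l, ∃ i, b i = v l) ∧ ∀ i, (∃ l, b i = v l ∧ β i = lam l) ∨
        ((∀ l, b i ≠ v l) ∧ β i = 0) := by
  classical
  obtain ⟨s, b, hs, hb⟩ := h.orthonormal.toSubtypeRange.exists_hilbertBasis_extension
  have key : ∀ i : s, ∃ β : ℝ, T (b i) = β • b i ∧ ((∃ l, b i = v l ∧ β = lam l) ∨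
        ((∀ l, b i ≠ v l) ∧ β = 0)) := by
    intro i
    by_cases hi : ∃ l, b i = v l
    · obtain ⟨l, hl⟩ := hi
      exact ⟨lam l, by rw [hl, h.eigen], Or.inl ⟨l, hl, rfl⟩⟩
    · push Not at hi
      refine ⟨0, ?_, Or.inr ⟨hi, rfl⟩⟩
      rw [zero_smul]
      refine h.complete _ fun l => ?_
      have hvl : v l ∈ s := hs ⟨l, rfl⟩
      have hbl : b ⟨v l, hvl⟩ = v l := by rw [hb]
      rw [← hbl]
      refine b.orthonormal.2 fun hne => hi l ?_
      rw [← hne, hbl]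
  choose β hβ hβ' using key
  refine ⟨s, b, β, hβ, fun l => ⟨⟨v l, hs ⟨l, rfl⟩⟩, by rw [hb]⟩, hβ'⟩

/-- Upper half of the min-max principle: on the remaining coordinates the diagonal entry is a later
eigenvalue or `0`, hence at most `lam l`. -/
theorem inner_apply_le [CompleteSpace H] (h : IsSpectralSystem T lam v) (l : ℕ) (x : H)
    (hx : ∀ j < l, inner ℝ (v j) x = 0) : inner ℝ x (T x) ≤ lam l * ‖x‖ ^ 2 := by
  obtain ⟨s, b, β, hβ, -, hcase⟩ := h.exists_hilbertBasis
  have h1 := b.hasSum_inner_mul_inner x (T x)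
  have h2 := (b.hasSum_inner_mul_inner x x).mul_left (lam l)
  rw [real_inner_self_eq_norm_sq] at h2
  refine hasSum_le (fun i => ?_) h1 h2
  have e : inner ℝ (b i) (T x) = β i * inner ℝ (b i) x := by
    rw [← h.symmetric, hβ, real_inner_smul_left]
  rw [e, real_inner_comm (b i) x]
  have key : β i * inner ℝ (b i) x ^ 2 ≤ lam l * inner ℝ (b i) x ^ 2 := by
    rcases hcase i with ⟨j, hj, hj'⟩ | ⟨-, h0⟩
    · rcases lt_or_ge j l with hjl | hjl
      · rw [hj, hx j hjl]; simp
      · rw [hj']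
        exact mul_le_mul_of_nonneg_right (h.antitone hjl) (sq_nonneg _)
    · rw [h0]
      exact mul_le_mul_of_nonneg_right (h.nonneg l) (sq_nonneg _)
  linarith

/-- Weyl's inequality. A nonzero `x` in the span of `v 0, …, v l` orthogonal to `w 0, …, w (l - 1)`
satisfies both `lam l * ‖x‖ ^ 2 ≤ ⟪x, T x⟫` and `⟪x, S x⟫ ≤ mu l * ‖x‖ ^ 2`. -/
theorem le_add_norm_sub [CompleteSpace H] (hT : IsSpectralSystem T lam v)
    (hS : IsSpectralSystem S mu w) (l : ℕ) : lam l ≤ mu l + ‖T - S‖ := by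
  -- Orthogonality imposes `l` linear conditions on `l + 1` coefficients.
  let φ : (Fin (l + 1) → ℝ) →ₗ[ℝ] (Fin l → ℝ) :=
    { toFun := fun c j => ∑ i, c i * inner ℝ (w j) (v i)
      map_add' := fun a b => by
        ext j; simp [add_mul, Finset.sum_add_distrib]
      map_smul' := fun a b => by
        ext j; simp [mul_assoc, Finset.mul_sum] }
  have hker : φ.ker ≠ ⊥ := LinearMap.ker_ne_bot_of_finrank_lt (by simp)
  obtain ⟨c, hc, hc0⟩ := (Submodule.ne_bot_iff _).1 hker
  set x : H := ∑ i, c i • v (i : ℕ) with hx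
  have hwx : ∀ j < l, inner ℝ (w j) x = 0 := by
    intro j hj
    have := congrFun (LinearMap.mem_ker.1 hc) ⟨j, hj⟩
    simpa [φ, hx, inner_sum, real_inner_smul_right] using this
  have hv : Orthonormal ℝ (fun i : Fin (l + 1) => v i) :=
    hT.orthonormal.comp _ Fin.val_injective
  have hTx : T x = ∑ i, (c i * lam i) • v (i : ℕ) := by
    simp [hx, hT.eigen, smul_smul]
  have hn : ‖x‖ ^ 2 = ∑ i, c i ^ 2 := by
    rw [← real_inner_self_eq_norm_sq, hx, hv.inner_sum]
    simp [sq]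
  have hin : inner ℝ x (T x) = ∑ i : Fin (l + 1), c i * (c i * lam i) := by
    rw [hTx, hx, hv.inner_sum]; simp
  have hlow : lam l * ‖x‖ ^ 2 ≤ inner ℝ x (T x) := by
    rw [hn, hin, Finset.mul_sum]
    refine Finset.sum_le_sum fun i _ => ?_
    have := mul_le_mul_of_nonneg_left (hT.antitone (Nat.lt_succ_iff.1 i.2)) (sq_nonneg (c i))
    linarith
  have hup := hS.inner_apply_le l x hwx
  have hdiff : inner ℝ x ((T - S) x) ≤ ‖T - S‖ * ‖x‖ ^ 2 := by
    calc inner ℝ x ((T - S) x) ≤ ‖x‖ * ‖(T - S) x‖ := real_inner_le_norm _ _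
      _ ≤ ‖x‖ * (‖T - S‖ * ‖x‖) := by gcongr; exact (T - S).le_opNorm x
      _ = _ := by ring
  have hxpos : 0 < ‖x‖ ^ 2 := by
    rw [hn]
    obtain ⟨i, hi⟩ := Function.ne_iff.1 hc0
    exact Finset.sum_pos' (fun _ _ => sq_nonneg _) ⟨i, Finset.mem_univ _, by have : c i ≠ 0 := hi; positivity⟩
  rw [_root_.sub_apply, inner_sub_right] at hdiff
  refine le_of_mul_le_mul_right ?_ hxpos
  linarith

theorem abs_sub_le_norm_sub [CompleteSpace H] (hT : IsSpectralSystem T lam v)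
    (hS : IsSpectralSystem S mu w) (l : ℕ) : |lam l - mu l| ≤ ‖T - S‖ := by
  have h1 := hT.le_add_norm_sub hS l
  have h2 := hS.le_add_norm_sub hT l
  rw [norm_sub_rev] at h2
  exact abs_sub_le_iff.2 ⟨by linarith, by linarith⟩

/-- By monotonicity only the neighbours of `l` matter. The bound `δ ≤ mu l` separates `mu l` from
the eigenvalue `0` of basis vectors outside the list `w`. -/
theorem exists_gap (hS : IsSpectralSystem S mu w) {l : ℕ} (hl : ∀ m, m ≠ l → mu m ≠ mu l) :
    ∃ δ > 0, δ ≤ mu l ∧ ∀ m, m ≠ l → δ ≤ |mu m - mu l| := by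
  have hsucc : mu (l + 1) < mu l :=
    lt_of_le_of_ne (hS.antitone (Nat.le_succ l)) (hl _ (Nat.succ_ne_self l))
  have hpred : ∃ δ > 0, ∀ m < l, δ ≤ mu m - mu l := by
    rcases l with _ | k
    · exact ⟨1, one_pos, fun m hm => absurd hm (Nat.not_lt_zero m)⟩
    · refine ⟨mu k - mu (k + 1), sub_pos.2 (lt_of_le_of_ne (hS.antitone (Nat.le_succ k))
        (hl k (Nat.succ_ne_self k).symm).symm), fun m hm => ?_⟩
      have := hS.antitone (Nat.lt_succ_iff.1 hm)
      linarith
  obtain ⟨δ, hδ, h⟩ := hpred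
  refine ⟨min δ (mu l - mu (l + 1)), lt_min hδ (sub_pos.2 hsucc),
    (min_le_right _ _).trans (by linarith [hS.nonneg (l + 1)]), fun m hm => ?_⟩
  rcases lt_or_gt_of_ne hm with hml | hml
  · exact (min_le_left _ _).trans ((h m hml).trans (le_abs_self _))
  · refine (min_le_right _ _).trans (le_trans ?_ (neg_le_abs _))
    have := hS.antitone (Nat.succ_le_of_lt hml)
    simp only [Nat.succ_eq_add_one] at this
    linarith

/-- In the eigenbasis, `S - mu l` multiplies every coordinate except that of `w l` by a factor of
modulus at least `δ`; Parseval concludes. -/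
theorem gap_sq_mul_le [CompleteSpace H] (hS : IsSpectralSystem S mu w) {l : ℕ} {δ : ℝ}
    (hδ : 0 ≤ δ) (hδl : δ ≤ mu l) (hgap : ∀ m, m ≠ l → δ ≤ |mu m - mu l|) (x : H) :
    δ ^ 2 * (‖x‖ ^ 2 - inner ℝ (w l) x ^ 2) ≤ ‖S x - mu l • x‖ ^ 2 := by
  classical
  obtain ⟨s, b, β, hβ, hex, hcase⟩ := hS.exists_hilbertBasis
  obtain ⟨i₀, hi₀⟩ := hex l
  have h1 := b.hasSum_inner_mul_inner (S x - mu l • x) (S x - mu l • x)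
  have h2 := ((b.hasSum_inner_mul_inner x x).sub
    (hasSum_ite_eq i₀ (inner ℝ (w l) x ^ 2))).mul_left (δ ^ 2)
  rw [real_inner_self_eq_norm_sq] at h1 h2
  refine hasSum_le (fun i => ?_) h2 h1
  have e : inner ℝ (b i) (S x - mu l • x) = (β i - mu l) * inner ℝ (b i) x := by
    rw [inner_sub_right, ← hS.symmetric, hβ, real_inner_smul_left, real_inner_smul_right]
    ring
  rw [real_inner_comm (b i), real_inner_comm (b i), e]
  split_ifs with hi
  · rw [hi, hi₀]
    have := mul_self_nonneg ((β i₀ - mu l) * inner ℝ (w l) x)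
    nlinarith
  · have hb : δ ≤ |β i - mu l| := by
      rcases hcase i with ⟨j, hj, hj'⟩ | ⟨-, h0⟩
      · rw [hj']
        refine hgap j fun hjl => hi ?_
        by_contra hne
        have : inner ℝ (b i) (b i₀) = 0 := b.orthonormal.2 hne
        rw [hi₀, hj, hjl, real_inner_self_eq_norm_sq, hS.orthonormal.1] at this
        norm_num at this
      · rw [h0, zero_sub, abs_neg]
        exact hδl.trans (le_abs_self _)
    have hsq : δ ^ 2 ≤ (β i - mu l) ^ 2 := by
      rw [← sq_abs (β i - mu l)]
      exact pow_le_pow_left₀ hδ hb 2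
    have := mul_le_mul_of_nonneg_right hsq (sq_nonneg (inner ℝ (b i) x))
    linarith

/-- With `a = ⟪y, x⟫ ≠ 0` the left side is `2 * (1 - |a|)`, and `a ^ 2 ≤ |a|`. If `a = 0` the sign
is `0` and the claim reads `1 ≤ 2`. -/
theorem norm_sub_sign_smul_sq_le {x y : H} (hx : ‖x‖ = 1) (hy : ‖y‖ = 1) :
    ‖x - Real.sign (inner ℝ y x) • y‖ ^ 2 ≤ 2 * (1 - inner ℝ y x ^ 2) := by
  have hle : |inner ℝ y x| ≤ 1 := by simpa [hx, hy] using abs_real_inner_le_norm y x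
  rw [abs_le] at hle
  rw [norm_sub_sq_real, norm_smul, real_inner_smul_right, real_inner_comm y x, hx, hy]
  rcases lt_trichotomy (inner ℝ y x) 0 with h | h | h
  · rw [Real.sign_of_neg h]
    norm_num
    nlinarith
  · rw [h]; norm_num
  · rw [Real.sign_of_pos h]
    norm_num
    nlinarith

/-- `v l` is nearly an eigenvector of `S`: its residual is at most `2 * ‖T - S‖`, one part from `T -
S` and one from Weyl. The constant is `8 = 2 * 2 ^ 2`. -/
theorem norm_eigenvector_sub_sq_le [CompleteSpace H] (hT : IsSpectralSystem T lam v)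
    (hS : IsSpectralSystem S mu w) {l : ℕ} {δ : ℝ} (hδ : 0 < δ) (hδl : δ ≤ mu l)
    (hgap : ∀ m, m ≠ l → δ ≤ |mu m - mu l|) :
    ‖v l - Real.sign (inner ℝ (w l) (v l)) • w l‖ ^ 2 ≤ 8 / δ ^ 2 * ‖T - S‖ ^ 2 := by
  have hv := hT.orthonormal.1 l
  have h1 := hS.gap_sq_mul_le hδ.le hδl hgap (v l)
  have h2 := norm_sub_sign_smul_sq_le hv (hS.orthonormal.1 l)
  have h3 : ‖S (v l) - mu l • v l‖ ≤ 2 * ‖T - S‖ := by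
    have e : S (v l) - mu l • v l = -((T - S) (v l)) + (lam l - mu l) • v l := by
      rw [_root_.sub_apply, hT.eigen, sub_smul]; abel
    rw [e]
    refine (norm_add_le _ _).trans ?_
    rw [norm_neg, norm_smul, hv, mul_one, Real.norm_eq_abs]
    have := (T - S).le_opNorm (v l)
    rw [hv, mul_one] at this
    linarith [hT.abs_sub_le_norm_sub hS l]
  have h4 : ‖S (v l) - mu l • v l‖ ^ 2 ≤ (2 * ‖T - S‖) ^ 2 :=
    pow_le_pow_left₀ (norm_nonneg _) h3 2
  rw [hv, one_pow] at h1
  refine h2.trans ?_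
  rw [div_mul_eq_mul_div, le_div_iff₀ (by positivity)]
  nlinarith

end IsSpectralSystem

/-! ### Deterministic limit of the split covariance operator -/

section RankOneAverages

open InnerProductSpace

variable {H : Type*} [NormedAddCommGroup H] [InnerProductSpace ℝ H]

/-- The sample covariance operator of the block of observations `x i`, `i ∈ s`, without the
normalizing factor. -/
noncomputable def blockScatter (x : ℕ → H) (s : Finset ℕ) (c : ℝ) : H →L[ℝ] H :=
  ∑ i ∈ s, rankOne ℝ (x i - c • ∑ j ∈ s, x j) (x i - c • ∑ j ∈ s, x j)

theorem rankOne_smul_smul (a b : ℝ) (x y : H) :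
    rankOne ℝ (a • x) (b • y) = (a * b) • rankOne ℝ x y := by
  ext z; simp [smul_smul, mul_comm a b]

theorem continuous_rankOne_apply : Continuous fun p : H × H => rankOne ℝ p.1 p.2 :=
  ((rankOne ℝ).continuous.comp continuous_fst).clm_apply continuous_snd

theorem continuous_rankOne_self : Continuous fun x : H => rankOne ℝ x x :=
  continuous_rankOne_apply.comp (continuous_id.prodMk continuous_id)

theorem tendsto_rankOne {α : Type*} {F : Filter α} {f g : α → H} {a b : H}
    (hf : Tendsto f F (𝓝 a)) (hg : Tendsto g F (𝓝 b)) :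
    Tendsto (fun n => rankOne ℝ (f n) (g n)) F (𝓝 (rankOne ℝ a b)) := by
  obtain ⟨Φ, hΦ, hΦc⟩ : ∃ Φ : H × H → (H →L[ℝ] H), (∀ p, Φ p = rankOne ℝ p.1 p.2) ∧
      Continuous Φ := ⟨_, fun _ => rfl, continuous_rankOne_apply⟩
  have h := (hΦc.tendsto (a, b)).comp (hf.prodMk_nhds hg)
  simpa only [Function.comp_def, hΦ] using h

theorem blockScatter_eq (x : ℕ → H) (s : Finset ℕ) :
    blockScatter x s (s.card : ℝ)⁻¹ = ∑ i ∈ s, rankOne ℝ (x i) (x i) -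
      (s.card : ℝ)⁻¹ • rankOne ℝ (∑ i ∈ s, x i) (∑ i ∈ s, x i) := by
  -- Empty blocks do occur (`k = 0` or `k = N`); both sides are then `0`.
  rcases s.eq_empty_or_nonempty with rfl | hs
  · simp [blockScatter]
  have hc : (s.card : ℝ) ≠ 0 := by exact_mod_cast hs.card_pos.ne'
  set c : ℝ := (s.card : ℝ)
  set S := ∑ i ∈ s, x i with hS
  have e : ∀ i, rankOne ℝ (x i - c⁻¹ • S) (x i - c⁻¹ • S) = rankOne ℝ (x i) (x i)
      - c⁻¹ • rankOne ℝ (x i) S - c⁻¹ • rankOne ℝ S (x i) + (c⁻¹ * c⁻¹) • rankOne ℝ S S := by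
    intro i
    simp only [map_sub, _root_.sub_apply, map_smul, _root_.smul_apply]
    module
  have e1 : ∑ i ∈ s, rankOne ℝ (x i) S = rankOne ℝ S S := by
    rw [← _root_.sum_apply, ← map_sum]
  have e2 : ∑ i ∈ s, rankOne ℝ S (x i) = rankOne ℝ S S := by
    rw [← map_sum]
  rw [blockScatter, Finset.sum_congr rfl fun i _ => e i, Finset.sum_add_distrib,
    Finset.sum_sub_distrib, Finset.sum_sub_distrib, ← Finset.smul_sum, ← Finset.smul_sum, e1, e2,
    Finset.sum_const, ← Nat.cast_smul_eq_nsmul ℝ, smul_smul]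
  have : (s.card : ℝ) * (c⁻¹ * c⁻¹) = c⁻¹ := by
    change c * (c⁻¹ * c⁻¹) = c⁻¹
    field_simp
  rw [this]; abel

/-- The sample covariance operator of a sample of size `N` split after `k` observations. -/
noncomputable def splitCovariance (x : ℕ → H) (N k : ℕ) : H →L[ℝ] H :=
  (N : ℝ)⁻¹ • (blockScatter x (Finset.range k) (k : ℝ)⁻¹ +
    blockScatter x (Finset.Ico k N) ((N : ℝ) - k)⁻¹)

theorem isPositive_splitCovariance (x : ℕ → H) (N k : ℕ) : (splitCovariance x N k).IsPositive := by
  refine ContinuousLinearMap.IsPositive.smul_of_nonneg (.add ?_ ?_) (by simp) <;>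
  exact ContinuousLinearMap.isPositive_sum _ fun i _ => isPositive_rankOne_self _

/-- In this form every average and every coefficient has a limit as `N` grows. -/
theorem splitCovariance_eq (x : ℕ → H) {N k : ℕ} (hk : k ≤ N) :
    splitCovariance x N k = (N : ℝ)⁻¹ • ∑ i ∈ Finset.range N, rankOne ℝ (x i) (x i)
      - ((k : ℝ) / N)⁻¹ • rankOne ℝ ((N : ℝ)⁻¹ • ∑ i ∈ Finset.range k, x i)
          ((N : ℝ)⁻¹ • ∑ i ∈ Finset.range k, x i)
      - (1 - (k : ℝ) / N)⁻¹ • rankOne ℝ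
          ((N : ℝ)⁻¹ • ∑ i ∈ Finset.range N, x i - (N : ℝ)⁻¹ • ∑ i ∈ Finset.range k, x i)
          ((N : ℝ)⁻¹ • ∑ i ∈ Finset.range N, x i - (N : ℝ)⁻¹ • ∑ i ∈ Finset.range k, x i) := by
  rcases Nat.eq_zero_or_pos N with rfl | hN
  · simp [splitCovariance]
  have hN' : (N : ℝ) ≠ 0 := by exact_mod_cast hN.ne'
  have h1 := blockScatter_eq x (Finset.range k)
  have h2 := blockScatter_eq x (Finset.Ico k N)
  rw [Finset.card_range] at h1
  rw [Nat.card_Ico, Nat.cast_sub hk, Finset.sum_Ico_eq_sub _ hk, Finset.sum_Ico_eq_sub _ hk] at h2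
  have e1 : ((k : ℝ) / N)⁻¹ * ((N : ℝ)⁻¹ * (N : ℝ)⁻¹) = (N : ℝ)⁻¹ * (k : ℝ)⁻¹ := by
    rw [inv_div]; field_simp
  have e2 : (1 - (k : ℝ) / N)⁻¹ * ((N : ℝ)⁻¹ * (N : ℝ)⁻¹) = (N : ℝ)⁻¹ * ((N : ℝ) - k)⁻¹ := by
    have : 1 - (k : ℝ) / N = (N - k) / N := by field_simp
    rw [this, inv_div]; field_simp
  rw [splitCovariance, h1, h2, ← smul_sub, rankOne_smul_smul, rankOne_smul_smul, smul_smul,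
    smul_smul, e1, e2]
  simp only [smul_add, smul_sub, smul_smul]
  abel

/-- Supplies the measurability needed to pass from almost sure convergence to convergence in
measure. -/
theorem continuous_splitCovariance (N k : ℕ) :
    Continuous fun x : ℕ → H => splitCovariance x N k := by
  have h : ∀ (s : Finset ℕ) (c : ℝ), Continuous fun x : ℕ → H => blockScatter x s c := by
    intro s c
    unfold blockScatter
    refine continuous_finsetSum _ fun i _ => (continuous_rankOne_self (H := H)).comp ?_
    fun_prop
  exact ((h _ _).add (h _ _)).const_smul ((N : ℝ)⁻¹)

theorem tendsto_floor_mul_div (a : ℝ) (ha : 0 ≤ a) :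
    Tendsto (fun N : ℕ => (⌊(N : ℝ) * a⌋₊ : ℝ) / N) atTop (𝓝 a) := by
  simpa only [mul_comm, Function.comp_def] using
    (tendsto_nat_floor_mul_div_atTop ha).comp tendsto_natCast_atTop_atTop

theorem tendsto_floor_mul_atTop {a : ℝ} (ha : 0 < a) :
    Tendsto (fun N : ℕ => ⌊(N : ℝ) * a⌋₊) atTop atTop :=
  tendsto_nat_floor_atTop.comp (tendsto_natCast_atTop_atTop.atTop_mul_const ha)

theorem floor_mul_le {a : ℝ} (ha : a ≤ 1) (N : ℕ) : ⌊(N : ℝ) * a⌋₊ ≤ N := by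
  refine (Nat.floor_le_floor (?_ : (N : ℝ) * a ≤ N)).trans (Nat.floor_natCast N).le
  exact mul_le_of_le_one_right (Nat.cast_nonneg N) ha

/-- The normalized partial sum is `⌊N a⌋ / N` times a genuine average of `⌊N a⌋` terms. -/
theorem tendsto_partial_average {y : ℕ → H}
    (hy : Tendsto (fun n : ℕ => (n : ℝ)⁻¹ • ∑ i ∈ Finset.range n, y i) atTop (𝓝 0))
    {a : ℝ} (ha : 0 < a) :
    Tendsto (fun N : ℕ => (N : ℝ)⁻¹ • ∑ i ∈ Finset.range ⌊(N : ℝ) * a⌋₊, y i) atTop (𝓝 0) := by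
  have h := (tendsto_floor_mul_div a ha.le).smul (hy.comp (tendsto_floor_mul_atTop ha))
  rw [smul_zero] at h
  refine h.congr' ?_
  filter_upwards [(tendsto_floor_mul_atTop ha).eventually_gt_atTop 0] with N hN
  have : (⌊(N : ℝ) * a⌋₊ : ℝ) ≠ 0 := by exact_mod_cast hN.ne'
  simp only [Function.comp_apply, smul_smul]
  congr 1
  field_simp

/-- A sequence with values `m₁` and `m₂` before and after the change point `p`, plus noise. -/
noncomputable def changePointSeq (m₁ m₂ : H) (y : ℕ → H) (p i : ℕ) : H :=
  (if i < p then m₁ else m₂) + y i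

theorem sum_range_changePoint {M : Type*} [AddCommGroup M] [Module ℝ M] (a b : M) (p n : ℕ) :
    ∑ i ∈ Finset.range n, (if i < p then a else b) =
      ((min n p : ℕ) : ℝ) • a + ((n : ℝ) - (min n p : ℕ)) • b := by
  induction n with
  | zero => simp
  | succ n ih =>
    rw [Finset.sum_range_succ, ih]
    split_ifs with h
    · rw [min_eq_left h.le, min_eq_left (Nat.succ_le_of_lt h)]
      push_cast
      module
    · rw [min_eq_right (not_lt.1 h), min_eq_right (by omega)]
      push_cast
      module

theorem tendsto_partial_average_changePoint {y : ℕ → H}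
    (hy : Tendsto (fun n : ℕ => (n : ℝ)⁻¹ • ∑ i ∈ Finset.range n, y i) atTop (𝓝 0))
    (m₁ m₂ : H) {θ u : ℝ} (hθ : 0 < θ) (hu : 0 < u) :
    Tendsto (fun N : ℕ => (N : ℝ)⁻¹ • ∑ i ∈ Finset.range ⌊(N : ℝ) * u⌋₊,
        changePointSeq m₁ m₂ y ⌊(N : ℝ) * θ⌋₊ i) atTop
      (𝓝 (min u θ • m₁ + (u - min u θ) • m₂)) := by
  have hmin := (tendsto_floor_mul_div u hu.le).min (tendsto_floor_mul_div θ hθ.le)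
  have h := ((hmin.smul_const m₁).add
    (((tendsto_floor_mul_div u hu.le).sub hmin).smul_const m₂)).add (tendsto_partial_average hy hu)
  rw [add_zero] at h
  refine h.congr fun N => ?_
  simp only [changePointSeq, Finset.sum_add_distrib, sum_range_changePoint, smul_add, smul_smul,
    Nat.cast_min, min_div_div_right (Nat.cast_nonneg (α := ℝ) N)]
  congr 3 <;> ring

/-- Expanding `(m + y i) ⊗ (m + y i)` on each side of the change, the cross terms pair `m` with
block sums of the noise divided by `N`, which vanish. -/
theorem tendsto_average_rankOne_changePoint {y : ℕ → H} {C : H →L[ℝ] H}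
    (hy : Tendsto (fun n : ℕ => (n : ℝ)⁻¹ • ∑ i ∈ Finset.range n, y i) atTop (𝓝 0))
    (hC : Tendsto (fun n : ℕ => (n : ℝ)⁻¹ • ∑ i ∈ Finset.range n, rankOne ℝ (y i) (y i)) atTop
      (𝓝 C))
    (m₁ m₂ : H) {θ : ℝ} (hθ : 0 < θ) (hθ1 : θ ≤ 1) :
    Tendsto (fun N : ℕ => (N : ℝ)⁻¹ • ∑ i ∈ Finset.range N,
        rankOne ℝ (changePointSeq m₁ m₂ y ⌊(N : ℝ) * θ⌋₊ i)
          (changePointSeq m₁ m₂ y ⌊(N : ℝ) * θ⌋₊ i)) atTop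
      (𝓝 (C + (θ • rankOne ℝ m₁ m₁ + (1 - θ) • rankOne ℝ m₂ m₂))) := by
  have hp := tendsto_partial_average hy hθ
  have hq : Tendsto (fun N : ℕ => (N : ℝ)⁻¹ • ∑ i ∈ Finset.range N, y i -
      (N : ℝ)⁻¹ • ∑ i ∈ Finset.range ⌊(N : ℝ) * θ⌋₊, y i) atTop (𝓝 0) := by
    simpa using hy.sub hp
  have hf := tendsto_floor_mul_div θ hθ.le
  have hmean := (hf.smul_const (rankOne ℝ m₁ m₁)).add
    ((hf.const_sub 1).smul_const (rankOne ℝ m₂ m₂))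
  have hc1 (m : H) := tendsto_rankOne (tendsto_const_nhds (x := m)) hp
  have hc2 (m : H) := tendsto_rankOne hp (tendsto_const_nhds (x := m))
  have hc3 (m : H) := tendsto_rankOne (tendsto_const_nhds (x := m)) hq
  have hc4 (m : H) := tendsto_rankOne hq (tendsto_const_nhds (x := m))
  have h := (hC.add hmean).add ((((hc1 m₁).add (hc2 m₁)).add (hc3 m₂)).add (hc4 m₂))
  simp only [map_zero, _root_.zero_apply, add_zero] at h
  refine h.congr' ?_
  filter_upwards [eventually_gt_atTop 0] with N hN
  have hN' : (N : ℝ) ≠ 0 := by exact_mod_cast hN.ne'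
  set p := ⌊(N : ℝ) * θ⌋₊ with hpdef
  have hpN : p ≤ N := floor_mul_le hθ1 N
  have hsplit : ∀ f : ℕ → H →L[ℝ] H, ∑ i ∈ Finset.range N, f i =
      ∑ i ∈ Finset.range p, f i + ∑ i ∈ Finset.Ico p N, f i := fun f =>
    (Finset.sum_range_add_sum_Ico f hpN).symm
  have hexp : ∀ m : H, ∀ s : Finset ℕ, ∑ i ∈ s, rankOne ℝ (m + y i) (m + y i) =
      (s.card : ℝ) • rankOne ℝ m m + rankOne ℝ m (∑ i ∈ s, y i) + rankOne ℝ (∑ i ∈ s, y i) m +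
        ∑ i ∈ s, rankOne ℝ (y i) (y i) := by
    intro m s
    simp only [map_add, _root_.add_apply, Finset.sum_add_distrib, map_sum,
      _root_.sum_apply, Finset.sum_const, Nat.cast_smul_eq_nsmul]
    abel
  have h1 : ∑ i ∈ Finset.range p, rankOne ℝ (changePointSeq m₁ m₂ y p i)
      (changePointSeq m₁ m₂ y p i) = ∑ i ∈ Finset.range p, rankOne ℝ (m₁ + y i) (m₁ + y i) :=
    Finset.sum_congr rfl fun i hi => by simp [changePointSeq, Finset.mem_range.1 hi]
  have h2 : ∑ i ∈ Finset.Ico p N, rankOne ℝ (changePointSeq m₁ m₂ y p i)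
      (changePointSeq m₁ m₂ y p i) = ∑ i ∈ Finset.Ico p N, rankOne ℝ (m₂ + y i) (m₂ + y i) :=
    Finset.sum_congr rfl fun i hi => by
      simp [changePointSeq, not_lt.2 (Finset.mem_Ico.1 hi).1]
  rw [hsplit fun i => rankOne ℝ (changePointSeq m₁ m₂ y p i) (changePointSeq m₁ m₂ y p i), h1, h2,
    hexp, hexp, Finset.card_range, Nat.card_Ico, Nat.cast_sub hpN,
    hsplit fun i => rankOne ℝ (y i) (y i), ← smul_sub, ← Finset.sum_Ico_eq_sub _ hpN]
  have e3 : (1 - (p : ℝ) / N) = (N : ℝ)⁻¹ * (N - p) := by field_simp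
  have e4 : (p : ℝ) / N = (N : ℝ)⁻¹ * p := by field_simp
  rw [e3, e4]
  simp only [map_smul, _root_.smul_apply]
  module

theorem rankOne_combination (a b : ℝ) (x y : H) :
    rankOne ℝ (a • x + b • y) (a • x + b • y) = (a * a) • rankOne ℝ x x +
      (a * b) • rankOne ℝ x y + (b * a) • rankOne ℝ y x + (b * b) • rankOne ℝ y y := by
  simp only [← rankOne_smul_smul, map_add, _root_.add_apply]
  abel

/-- Within-block variance of the step function equal to `m₁` on `[0, θ]` and `m₂` on `(θ, 1]`: `a •
m₁ + (u - a) • m₂` is its integral over `[0, u]`. Only a block with `θ` in its interior contributes.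
-/
theorem between_block_identity (m₁ m₂ : H) {θ u : ℝ} (hθ0 : 0 < θ) (hθ1 : θ < 1) (hu0 : 0 < u)
    (hu1 : u ≤ 1) (a : ℝ) (ha : a = min u θ) :
    θ • rankOne ℝ m₁ m₁ + (1 - θ) • rankOne ℝ m₂ m₂
      - u⁻¹ • rankOne ℝ (a • m₁ + (u - a) • m₂) (a • m₁ + (u - a) • m₂)
      - (1 - u)⁻¹ • rankOne ℝ ((θ • m₁ + (1 - θ) • m₂) - (a • m₁ + (u - a) • m₂))
          ((θ • m₁ + (1 - θ) • m₂) - (a • m₁ + (u - a) • m₂)) =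
      (θ * (1 - θ) * biasFactor θ u) • rankOne ℝ (m₁ - m₂) (m₁ - m₂) := by
  have e1 : (θ • m₁ + (1 - θ) • m₂) - (a • m₁ + (u - a) • m₂) =
      (θ - a) • m₁ + (1 - θ - (u - a)) • m₂ := by module
  have e2 : m₁ - m₂ = (1 : ℝ) • m₁ + (-1 : ℝ) • m₂ := by module
  rw [e1, e2, rankOne_combination, rankOne_combination, rankOne_combination]
  have h1θ : 1 - θ ≠ 0 := by linarith
  rcases le_or_gt u θ with h | h
  · have h1u : 1 - u ≠ 0 := by linarith
    have hb : θ * (1 - θ) * biasFactor θ u = (1 - θ) * (θ - u) / (1 - u) := by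
      rw [biasFactor, max_eq_right h, min_eq_left h]; field_simp
    rw [hb]
    rw [min_eq_left h] at ha
    subst ha
    match_scalars <;> field_simp <;> ring
  · have hb : θ * (1 - θ) * biasFactor θ u = θ * (u - θ) / u := by
      rw [biasFactor, max_eq_left h.le, min_eq_right h.le]; field_simp
    rw [hb]
    rw [min_eq_right h.le] at ha
    subst ha
    -- At `u = 1` the second block is empty and `(1 - u)⁻¹ = 0`.
    rcases eq_or_lt_of_le hu1 with rfl | h1
    · match_scalars <;> ring
    · have h1u : 1 - u ≠ 0 := by linarith
      match_scalars <;> field_simp <;> ring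

theorem biasFactor_nonneg {θ u : ℝ} (hθ0 : 0 < θ) (hθ1 : θ < 1) : 0 ≤ biasFactor θ u := by
  have h1 : min u θ ≤ θ := min_le_right _ _
  have h2 : θ ≤ max u θ := le_max_right _ _
  exact div_nonneg (by linarith) (mul_nonneg (by linarith) (by linarith))

theorem tendsto_splitCovariance {y : ℕ → H} {C : H →L[ℝ] H}
    (hy : Tendsto (fun n : ℕ => (n : ℝ)⁻¹ • ∑ i ∈ Finset.range n, y i) atTop (𝓝 0))
    (hC : Tendsto (fun n : ℕ => (n : ℝ)⁻¹ • ∑ i ∈ Finset.range n, rankOne ℝ (y i) (y i)) atTop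
      (𝓝 C))
    (m₁ m₂ : H) {θ u : ℝ} (hθ0 : 0 < θ) (hθ1 : θ < 1) (hu0 : 0 < u) (hu1 : u ≤ 1) :
    Tendsto (fun N : ℕ => splitCovariance (changePointSeq m₁ m₂ y ⌊(N : ℝ) * θ⌋₊) N
        ⌊(N : ℝ) * u⌋₊) atTop
      (𝓝 (C + (θ * (1 - θ) * biasFactor θ u) • rankOne ℝ (m₁ - m₂) (m₁ - m₂))) := by
  have h1 := tendsto_average_rankOne_changePoint hy hC m₁ m₂ hθ0 hθ1.le
  have h2 := tendsto_partial_average_changePoint hy m₁ m₂ hθ0 hu0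
  have h3 := tendsto_partial_average_changePoint hy m₁ m₂ hθ0 one_pos
  simp only [mul_one, Nat.floor_natCast, min_eq_right hθ1.le] at h3
  have hk := tendsto_floor_mul_div u hu0.le
  have hkinv := hk.inv₀ hu0.ne'
  have hkinv' : Tendsto (fun N : ℕ => (1 - (⌊(N : ℝ) * u⌋₊ : ℝ) / N)⁻¹) atTop
      (𝓝 (1 - u)⁻¹) := by
    -- Inversion is discontinuous at `0`, but for `u = 1` the coefficient is exactly `0⁻¹ = 0` once
    -- `N > 0`.
    rcases eq_or_lt_of_le hu1 with rfl | h
    · refine tendsto_const_nhds.congr' ?_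
      filter_upwards [eventually_gt_atTop 0] with N hN
      have hN' : (N : ℝ) ≠ 0 := by exact_mod_cast hN.ne'
      simp [hN']
    · exact (hk.const_sub 1).inv₀ (by linarith)
  have h := (h1.sub (hkinv.smul (tendsto_rankOne h2 h2))).sub
    (hkinv'.smul (tendsto_rankOne (h3.sub h2) (h3.sub h2)))
  rw [← between_block_identity m₁ m₂ hθ0 hθ1 hu0 hu1 _ rfl]
  have e : ∀ a b c d : H →L[ℝ] H, a + (b - c - d) = a + b - c - d := fun a b c d => by abel
  rw [e]
  exact h.congr fun N => (splitCovariance_eq _ (floor_mul_le hu1 N)).symm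

end RankOneAverages

/-! ### Integral kernels and their operators -/

section Kernels

open InnerProductSpace

/-- The integral operator on `L²([0,1])` with kernel `κ` is defined everywhere and equals `T`. -/
def IsKernelOf (κ : unitInterval → unitInterval → ℝ) (T : L2I →L[ℝ] L2I) : Prop :=
  ∀ x : L2I, ∀ᵐ t : unitInterval, Integrable (fun s => κ t s * x s) ∧ ∫ s, κ t s * x s = T x t

namespace IsKernelOf

variable {κ κ' : unitInterval → unitInterval → ℝ} {T T' : L2I →L[ℝ] L2I}

theorem zero : IsKernelOf (fun _ _ => 0) 0 := fun x => ae_of_all _ fun t => by simp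

theorem add (h : IsKernelOf κ T) (h' : IsKernelOf κ' T') :
    IsKernelOf (fun t s => κ t s + κ' t s) (T + T') := fun x => by
  filter_upwards [h x, h' x, Lp.coeFn_add (T x) (T' x)] with t ht ht' hadd
  simp only [add_mul]
  refine ⟨ht.1.add ht'.1, ?_⟩
  rw [integral_add ht.1 ht'.1, ht.2, ht'.2, _root_.add_apply, hadd, Pi.add_apply]

theorem const_mul (h : IsKernelOf κ T) (a : ℝ) :
    IsKernelOf (fun t s => a * κ t s) (a • T) := fun x => by
  filter_upwards [h x, Lp.coeFn_smul a (T x)] with t ht hsmul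
  simp only [mul_assoc]
  refine ⟨ht.1.const_mul a, ?_⟩
  rw [integral_const_mul, ht.2, _root_.smul_apply, hsmul, Pi.smul_apply, smul_eq_mul]

theorem sum {ι : Type*} (S : Finset ι) {κ : ι → unitInterval → unitInterval → ℝ}
    {T : ι → L2I →L[ℝ] L2I} (h : ∀ i ∈ S, IsKernelOf (κ i) (T i)) :
    IsKernelOf (fun t s => ∑ i ∈ S, κ i t s) (∑ i ∈ S, T i) := by
  classical
  induction S using Finset.induction_on with
  | empty => simpa using zero
  | insert i S hi ih =>
    simp only [Finset.sum_insert hi]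
    exact (h i (Finset.mem_insert_self _ _)).add
      (ih fun j hj => h j (Finset.mem_insert_of_mem hj))

theorem rankOne {f g : unitInterval → ℝ} {F G : L2I} (hf : F =ᵐ[volume] f)
    (hg : G =ᵐ[volume] g) :
    IsKernelOf (fun t s => f t * g s) (InnerProductSpace.rankOne ℝ F G) := fun x => by
  have hint : Integrable (fun s => g s * x s) := by
    refine (L2.integrable_inner (𝕜 := ℝ) x G).congr ?_
    filter_upwards [hg] with s hs
    simp [hs]
  have hin : inner ℝ G x = ∫ s, g s * x s := by
    rw [real_inner_comm, L2.inner_def]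
    refine integral_congr_ae ?_
    filter_upwards [hg] with s hs
    simp [hs]
  filter_upwards [hf, Lp.coeFn_smul (inner ℝ G x) F] with t ht hsmul
  simp only [mul_assoc]
  refine ⟨hint.const_mul _, ?_⟩
  rw [integral_const_mul, rankOne_apply, hsmul, Pi.smul_apply, ht, hin, smul_eq_mul, mul_comm]

/-- Nonnegativity of the eigenvalues is not part of `IsEigensystem`; it comes from `0 ≤ ⟪v l, T (v
l)⟫`. -/
theorem isSpectralSystem (h : IsKernelOf κ T) (hT : T.IsPositive) {lam : ℕ → ℝ} {v : ℕ → L2I}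
    (hv : IsEigensystem κ lam v) : IsSpectralSystem T lam v := by
  have heigen : ∀ l, T (v l) = lam l • v l := fun l => by
    refine Lp.ext ?_
    filter_upwards [h (v l), hv.eigen l, Lp.coeFn_smul (lam l) (v l)] with t h1 h2 h3
    rw [← h1.2, h2, h3, Pi.smul_apply, smul_eq_mul]
  refine ⟨hv.antitone, fun l => ?_, hv.orthonormal, hT.inner_left_eq_inner_right, heigen,
    fun x hx => ?_⟩
  · have := hT.inner_nonneg_right (v l)
    rwa [heigen, real_inner_smul_right, real_inner_self_eq_norm_sq, hv.orthonormal.1, one_pow,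
      mul_one] at this
  · refine Lp.ext ?_
    filter_upwards [h x, hv.complete x hx, Lp.coeFn_zero ℝ 2 (volume : Measure unitInterval)]
      with t h1 h2 h3
    rw [← h1.2, h2, h3, Pi.zero_apply]

end IsKernelOf

/-- `L²([0,1])` is separable. -/
instance : SecondCountableTopology L2I := by
  have : Fact ((2 : ENNReal) ≠ ⊤) := ⟨by simp⟩
  infer_instance

variable {Ω : Type*} [MeasurableSpace Ω] {P : Measure Ω}
  {Y : ℕ → Ω → unitInterval → ℝ}

/-! ### Covariance operator and strong laws for the noise -/

namespace IsIIDNoise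

/-- The noise as a sequence of random elements of `L²([0,1])`. -/
noncomputable def toL2 (hY : IsIIDNoise P Y) (i : ℕ) (ω : Ω) : L2I := (hY.path_memLp i ω).toLp (Y i ω)

variable (hY : IsIIDNoise P Y)
include hY

theorem coeFn_toL2 (i : ℕ) (ω : Ω) : hY.toL2 i ω =ᵐ[volume] Y i ω :=
  (hY.path_memLp i ω).coeFn_toLp

theorem aestronglyMeasurable_toL2 (i : ℕ) : AEStronglyMeasurable (hY.toL2 i) P :=
  (hY.identDistrib i).aemeasurable_fst.aestronglyMeasurable

theorem norm_toL2_sq (i : ℕ) (ω : Ω) : ‖hY.toL2 i ω‖ ^ 2 = ∫ t, Y i ω t ^ 2 := by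
  rw [← real_inner_self_eq_norm_sq, L2.inner_def]
  refine integral_congr_ae ?_
  filter_upwards [hY.coeFn_toL2 i ω] with t ht
  simp [ht, sq]

theorem integrable_norm_toL2_sq (i : ℕ) : Integrable (fun ω => ‖hY.toL2 i ω‖ ^ 2) P := by
  simpa only [hY.norm_toL2_sq] using hY.second_moment i

theorem integrable_toL2 [IsFiniteMeasure P] (i : ℕ) : Integrable (hY.toL2 i) P :=
  ((memLp_two_iff_integrable_sq_norm (hY.aestronglyMeasurable_toL2 i)).2
    (hY.integrable_norm_toL2_sq i)).integrable one_le_two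

/-- The operator norm of `y ⊗ y` is `‖y‖ ^ 2`, so the second moment is what Bochner integrability
needs. -/
theorem integrable_rankOne (i : ℕ) :
    Integrable (fun ω => rankOne ℝ (hY.toL2 i ω) (hY.toL2 i ω)) P := by
  refine (hY.integrable_norm_toL2_sq i).mono'
    (continuous_rankOne_self.comp_aestronglyMeasurable (hY.aestronglyMeasurable_toL2 i)) ?_
  exact ae_of_all _ fun ω => by rw [norm_rankOne, sq]

/-- The covariance operator of the noise. -/
noncomputable def covOp : L2I →L[ℝ] L2I := ∫ ω, rankOne ℝ (hY.toL2 0 ω) (hY.toL2 0 ω) ∂P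

theorem covOp_apply (x : L2I) :
    hY.covOp x = ∫ ω, inner ℝ (hY.toL2 0 ω) x • hY.toL2 0 ω ∂P := by
  rw [covOp, ContinuousLinearMap.integral_apply (hY.integrable_rankOne 0)]
  simp

theorem integrable_covOp_apply (x : L2I) :
    Integrable (fun ω => inner ℝ (hY.toL2 0 ω) x • hY.toL2 0 ω) P := by
  simpa using (hY.integrable_rankOne 0).apply_continuousLinearMap x

theorem inner_covOp_apply (g x : L2I) :
    inner ℝ g (hY.covOp x) = ∫ ω, inner ℝ (hY.toL2 0 ω) x * inner ℝ g (hY.toL2 0 ω) ∂P := by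
  rw [covOp_apply, ← integral_inner (hY.integrable_covOp_apply x)]
  simp only [real_inner_smul_right]

theorem isPositive_covOp : hY.covOp.IsPositive := by
  refine (ContinuousLinearMap.isPositive_iff _).2 ⟨fun x y => ?_, fun x => ?_⟩
  · change inner ℝ (hY.covOp x) y = inner ℝ x (hY.covOp y)
    rw [real_inner_comm, inner_covOp_apply, inner_covOp_apply]
    refine integral_congr_ae (ae_of_all _ fun ω => ?_)
    simp only
    rw [real_inner_comm x, real_inner_comm y, mul_comm]
  · rw [real_inner_comm, inner_covOp_apply]
    refine integral_nonneg fun ω => ?_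
    simp only
    rw [real_inner_comm x]
    exact mul_self_nonneg _

theorem integral_norm_mul_norm_le (i : ℕ) (ω : Ω) {g : unitInterval → ℝ}
    (hg : MemLp g 2 volume) :
    ∫ t, ‖Y i ω t‖ * ‖g t‖ ≤ ‖hY.toL2 i ω‖ * ‖hg.toLp g‖ := by
  have hf := hY.path_memLp i ω
  have h := real_inner_le_norm (hf.norm.toLp _) (hg.norm.toLp _)
  rw [Lp.norm_toLp, Lp.norm_toLp, eLpNorm_norm, eLpNorm_norm, L2.inner_def] at h
  rw [toL2, Lp.norm_toLp, Lp.norm_toLp]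
  refine le_trans (le_of_eq (integral_congr_ae ?_)) h
  filter_upwards [hf.norm.coeFn_toLp, hg.norm.coeFn_toLp] with t h1 h2
  rw [h1, h2]
  simp [mul_comm]

theorem integral_norm_le (i : ℕ) (ω : Ω) : ∫ t, ‖Y i ω t‖ ≤ ‖hY.toL2 i ω‖ := by
  have h := hY.integral_norm_mul_norm_le i ω (memLp_const (1 : ℝ))
  rw [Lp.norm_toLp, eLpNorm_const _ (by simp) (NeZero.ne _)] at h
  simpa using h

theorem ae_tendsto_average_rankOne :
    ∀ᵐ ω ∂P, Tendsto (fun n : ℕ => (n : ℝ)⁻¹ • ∑ i ∈ Finset.range n,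
      rankOne ℝ (hY.toL2 i ω) (hY.toL2 i ω)) atTop (𝓝 hY.covOp) := by
  have hm : Measurable fun x : L2I => rankOne ℝ x x := continuous_rankOne_self.measurable
  exact strong_law_ae (fun i ω => rankOne ℝ (hY.toL2 i ω) (hY.toL2 i ω)) (hY.integrable_rankOne 0)
    (fun i j hij => (hY.indep.indepFun hij).comp hm hm) (fun i => (hY.identDistrib i).comp hm)

/-- The function `(ω, (t, s)) ↦ Y(t) Y(s) x(s)` is integrable. -/
theorem integrable_triple (x : L2I) :
    Integrable (fun p : Ω × unitInterval × unitInterval =>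
      Y 0 p.1 p.2.1 * (Y 0 p.1 p.2.2 * x p.2.2)) (P.prod (volume.prod volume)) := by
  have hx := (Lp.stronglyMeasurable x).measurable
  have hm := hY.measurable 0
  have hmeas : Measurable (fun p : Ω × unitInterval × unitInterval =>
      Y 0 p.1 p.2.1 * (Y 0 p.1 p.2.2 * x p.2.2)) := by
    refine (hm.comp (measurable_fst.prodMk (measurable_fst.comp measurable_snd))).mul
      ((hm.comp (measurable_fst.prodMk (measurable_snd.comp measurable_snd))).mul
        (hx.comp (measurable_snd.comp measurable_snd)))
  have hY1 : ∀ ω, Integrable (Y 0 ω) := fun ω => (hY.path_memLp 0 ω).integrable one_le_two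
  have hYx : ∀ ω, Integrable (fun s => Y 0 ω s * x s) := fun ω =>
    (hY.path_memLp 0 ω).integrable_mul (Lp.memLp x)
  refine (integrable_prod_iff hmeas.aestronglyMeasurable).2
    ⟨ae_of_all _ fun ω => (hY1 ω).mul_prod (hYx ω), ?_⟩
  -- By Cauchy–Schwarz, applied in `t` and in `s`, the inner integral is at most `‖Y‖ ^ 2 * ‖x‖`.
  refine ((hY.integrable_norm_toL2_sq 0).mul_const ‖x‖).mono'
    (hmeas.norm.stronglyMeasurable.integral_prod_right').aestronglyMeasurable
    (ae_of_all _ fun ω => ?_)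
  simp only [norm_mul]
  rw [integral_prod_mul (fun t => ‖Y 0 ω t‖) fun s => ‖Y 0 ω s‖ * ‖x s‖, Real.norm_of_nonneg
    (mul_nonneg (by positivity) (by positivity))]
  have h1 := hY.integral_norm_le 0 ω
  have h2 := hY.integral_norm_mul_norm_le 0 ω (Lp.memLp x)
  rw [Lp.toLp_coeFn] at h2
  calc _ ≤ ‖hY.toL2 0 ω‖ * (‖hY.toL2 0 ω‖ * ‖x‖) := by gcongr
    _ = _ := by ring

variable [IsProbabilityMeasure P]

theorem integrable_prod (i : ℕ) :
    Integrable (fun p : Ω × unitInterval => Y i p.1 p.2) (P.prod volume) := by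
  refine (integrable_prod_iff (hY.measurable i).aestronglyMeasurable).2
    ⟨ae_of_all _ fun ω => (hY.path_memLp i ω).integrable one_le_two, ?_⟩
  refine (hY.integrable_toL2 i).norm.mono'
    ((hY.measurable i).norm.stronglyMeasurable.integral_prod_right').aestronglyMeasurable
    (ae_of_all _ fun ω => ?_)
  rw [Real.norm_of_nonneg (by positivity)]
  exact hY.integral_norm_le i ω

/-- The Bochner mean and the pointwise mean agree almost everywhere: test against indicators and
apply Fubini. -/
theorem integral_toL2 (i : ℕ) : ∫ ω, hY.toL2 i ω ∂P = 0 := by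
  have hae : ((∫ ω, hY.toL2 i ω ∂P : L2I) : unitInterval → ℝ) =ᵐ[volume]
      fun t => ∫ ω, Y i ω t ∂P := by
    refine Integrable.ae_eq_of_forall_setIntegral_eq _ _
      ((Lp.memLp _).integrable one_le_two) (hY.integrable_prod i).integral_prod_right
      fun A hA _ => ?_
    rw [← L2.inner_indicatorConstLp_one (𝕜 := ℝ) hA (measure_ne_top _ _),
      ← integral_inner (hY.integrable_toL2 i)]
    simp only [L2.inner_indicatorConstLp_one]
    rw [← integral_integral_swap (f := fun ω t => Y i ω t)
      ((hY.integrable_prod i).mono_measure (Measure.prod_mono le_rfl Measure.restrict_le_self))]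
    exact integral_congr_ae (ae_of_all _ fun ω =>
      integral_congr_ae (ae_restrict_of_ae (hY.coeFn_toL2 i ω)))
  refine Lp.ext ?_
  filter_upwards [hae, hY.mean_zero i, Lp.coeFn_zero ℝ 2 (volume : Measure unitInterval)]
    with t h1 h2 h3
  rw [h1, h2, h3, Pi.zero_apply]

theorem ae_tendsto_average :
    ∀ᵐ ω ∂P, Tendsto (fun n : ℕ => (n : ℝ)⁻¹ • ∑ i ∈ Finset.range n, hY.toL2 i ω) atTop (𝓝 0) := by
  have h := strong_law_ae hY.toL2 (hY.integrable_toL2 0)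
    (fun i j hij => hY.indep.indepFun hij) hY.identDistrib
  rwa [hY.integral_toL2 0] at h

/-- Both functions have the same integral over every measurable `A`, by Fubini for `Y(t) Y(s) x(s)`;
the same integrability makes almost every section integrable. -/
theorem isKernelOf_covKernel : IsKernelOf (covKernel P Y) hY.covOp := fun x => by
  have hint := hY.integrable_triple x
  have hκ : ∀ t s, ∫ ω, Y 0 ω t * (Y 0 ω s * x s) ∂P = covKernel P Y t s * x s := fun t s => by
    rw [covKernel, ← integral_mul_const]
    simp only [mul_assoc]
  have hR := hint.integral_prod_right
  simp only [hκ] at hR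
  have hae : (fun t => ∫ s, covKernel P Y t s * x s) =ᵐ[volume] hY.covOp x := by
    refine Integrable.ae_eq_of_forall_setIntegral_eq _ _ hR.integral_prod_left
      ((Lp.memLp (hY.covOp x)).integrable one_le_two) fun A hA _ => ?_
    rw [← L2.inner_indicatorConstLp_one (𝕜 := ℝ) hA (measure_ne_top _ _), inner_covOp_apply]
    have h1 : ∀ ω, inner ℝ (hY.toL2 0 ω) x *
        inner ℝ (indicatorConstLp 2 hA (measure_ne_top volume A) 1) (hY.toL2 0 ω) =
        ∫ p : unitInterval × unitInterval, Y 0 ω p.1 * (Y 0 ω p.2 * x p.2)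
          ∂((volume.restrict A).prod volume) := fun ω => by
      rw [integral_prod_mul (Y 0 ω) fun s => Y 0 ω s * x s, L2.inner_indicatorConstLp_one,
        mul_comm]
      congr 1
      · exact integral_congr_ae (ae_restrict_of_ae (hY.coeFn_toL2 0 ω))
      · rw [L2.inner_def]
        refine integral_congr_ae ?_
        filter_upwards [hY.coeFn_toL2 0 ω] with t ht
        simp [ht, mul_comm]
    simp only [h1]
    have hint' : Integrable (fun p : Ω × unitInterval × unitInterval =>
        Y 0 p.1 p.2.1 * (Y 0 p.1 p.2.2 * x p.2.2))
        (P.prod ((volume.restrict A).prod volume)) := by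
      refine hint.mono_measure (Measure.prod_mono le_rfl ?_)
      exact Measure.prod_mono Measure.restrict_le_self le_rfl
    rw [integral_integral_swap (f := fun ω (p : unitInterval × unitInterval) =>
      Y 0 ω p.1 * (Y 0 ω p.2 * x p.2)) hint']
    simp only [hκ]
    have hR' := hint'.integral_prod_right
    simp only [hκ] at hR'
    rw [integral_prod _ hR']
  filter_upwards [hR.prod_right_ae, hae] with t h1 h2 using ⟨h1, h2⟩

end IsIIDNoise

end Kernels

/-! ### The change-point model as random operators -/

section ChangePointModel

open InnerProductSpace

variable {f : ℕ → unitInterval → ℝ} {F : ℕ → L2I}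

theorem coeFn_const_smul_sum (s : Finset ℕ) (c : ℝ) (hF : ∀ i, F i =ᵐ[volume] f i) :
    (c • ∑ i ∈ s, F i : L2I) =ᵐ[volume] fun t => c * ∑ i ∈ s, f i t := by
  filter_upwards [Lp.coeFn_smul c (∑ i ∈ s, F i), Lp.coeFn_finsetSum s F, ae_all_iff.2 hF]
    with t h1 h2 h3
  rw [h1, Pi.smul_apply, h2, Finset.sum_apply, smul_eq_mul]
  simp only [h3]

theorem isKernelOf_blockScatter (s : Finset ℕ) (c : ℝ) (hF : ∀ i, F i =ᵐ[volume] f i) :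
    IsKernelOf (fun t r => ∑ i ∈ s, (f i t - c * ∑ j ∈ s, f j t) * (f i r - c * ∑ j ∈ s, f j r))
      (blockScatter F s c) := by
  refine IsKernelOf.sum s fun i _ => ?_
  have h : (F i - c • ∑ j ∈ s, F j : L2I) =ᵐ[volume] fun t => f i t - c * ∑ j ∈ s, f j t := by
    filter_upwards [Lp.coeFn_sub (F i) (c • ∑ j ∈ s, F j), hF i, coeFn_const_smul_sum s c hF]
      with t h1 h2 h3
    rw [h1, Pi.sub_apply, h2, h3]
  exact IsKernelOf.rankOne h h

theorem isKernelOf_empCovKernel (hF : ∀ i, F i =ᵐ[volume] f i) (N : ℕ) (u : ℝ) :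
    IsKernelOf (empCovKernel f N u) (splitCovariance F N ⌊(N : ℝ) * u⌋₊) := by
  have h := ((isKernelOf_blockScatter (Finset.range ⌊(N : ℝ) * u⌋₊)
    (⌊(N : ℝ) * u⌋₊ : ℝ)⁻¹ hF).add (isKernelOf_blockScatter (Finset.Ico ⌊(N : ℝ) * u⌋₊ N)
    ((N : ℝ) - ⌊(N : ℝ) * u⌋₊)⁻¹ hF)).const_mul (N : ℝ)⁻¹
  simp only [← one_div] at h
  simp only [splitCovariance, ← one_div]
  exact h

variable {Ω : Type*} [MeasurableSpace Ω] {P : Measure Ω}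
  {Y : ℕ → Ω → unitInterval → ℝ} {μ₁ μ₂ : unitInterval → ℝ}

theorem coeFn_changePointSeq (hY : IsIIDNoise P Y) (hμ₁ : MemLp μ₁ 2 volume)
    (hμ₂ : MemLp μ₂ 2 volume) (θ : ℝ) (N i : ℕ) (ω : Ω) :
    (changePointSeq (hμ₁.toLp μ₁) (hμ₂.toLp μ₂) (fun j => hY.toL2 j ω) ⌊(N : ℝ) * θ⌋₊ i : L2I)
      =ᵐ[volume] changePointObs θ μ₁ μ₂ Y N i ω := by
  unfold changePointSeq changePointObs
  split_ifs
  · filter_upwards [Lp.coeFn_add (hμ₁.toLp μ₁) (hY.toL2 i ω), hμ₁.coeFn_toLp, hY.coeFn_toL2 i ω]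
      with t h1 h2 h3
    rw [h1, Pi.add_apply, h2, h3]
  · filter_upwards [Lp.coeFn_add (hμ₂.toLp μ₂) (hY.toL2 i ω), hμ₂.coeFn_toLp, hY.coeFn_toL2 i ω]
      with t h1 h2 h3
    rw [h1, Pi.add_apply, h2, h3]

variable [IsProbabilityMeasure P]

theorem isKernelOf_limitKernel (hY : IsIIDNoise P Y) (hμ₁ : MemLp μ₁ 2 volume)
    (hμ₂ : MemLp μ₂ 2 volume) (θ u : ℝ) :
    IsKernelOf (limitKernel P θ μ₁ μ₂ Y u)
      (hY.covOp + (θ * (1 - θ) * biasFactor θ u) •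
        rankOne ℝ (hμ₁.toLp μ₁ - hμ₂.toLp μ₂) (hμ₁.toLp μ₁ - hμ₂.toLp μ₂)) := by
  have hΔ : (hμ₁.toLp μ₁ - hμ₂.toLp μ₂ : L2I) =ᵐ[volume] fun t => μ₁ t - μ₂ t := by
    filter_upwards [Lp.coeFn_sub (hμ₁.toLp μ₁) (hμ₂.toLp μ₂), hμ₁.coeFn_toLp, hμ₂.coeFn_toLp]
      with t h1 h2 h3
    rw [h1, Pi.sub_apply, h2, h3]
  have h := hY.isKernelOf_covKernel.add
    ((IsKernelOf.rankOne hΔ hΔ).const_mul (θ * (1 - θ) * biasFactor θ u))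
  convert h using 3 with t s
  rw [limitKernel]
  ring

/-- The estimated covariance operator converges in probability in operator norm. -/
theorem tendstoInMeasure_splitCovariance (hY : IsIIDNoise P Y) (m₁ m₂ : L2I) {θ u : ℝ}
    (hθ : θ ∈ Set.Ioo (0 : ℝ) 1) (hu : u ∈ Set.Ioc (0 : ℝ) 1) :
    TendstoInMeasure P (fun (N : ℕ) ω =>
        splitCovariance (changePointSeq m₁ m₂ (fun j => hY.toL2 j ω) ⌊(N : ℝ) * θ⌋₊) N
          ⌊(N : ℝ) * u⌋₊) atTop
      (fun _ => hY.covOp + (θ * (1 - θ) * biasFactor θ u) • rankOne ℝ (m₁ - m₂) (m₁ - m₂)) := by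
  refine tendstoInMeasure_of_tendsto_ae (fun N => ?_) ?_
  · have hc : Continuous fun y : ℕ → L2I =>
        splitCovariance (changePointSeq m₁ m₂ y ⌊(N : ℝ) * θ⌋₊) N ⌊(N : ℝ) * u⌋₊ := by
      refine (continuous_splitCovariance N _).comp (continuous_pi fun i => ?_)
      exact continuous_const.add (continuous_apply i)
    refine hc.comp_aestronglyMeasurable (f := fun ω j => hY.toL2 j ω) ?_
    exact (aemeasurable_pi_iff.2 fun i =>
      (hY.aestronglyMeasurable_toL2 i).aemeasurable).aestronglyMeasurable
  · filter_upwards [hY.ae_tendsto_average, hY.ae_tendsto_average_rankOne] with ω h1 h2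
    exact tendsto_splitCovariance h1 h2 m₁ m₂ hθ.1 hθ.2 hu.1 hu.2

end ChangePointModel

/-! ### Transfer to eigenvalues and eigenfunctions -/

/-- Only inclusion of events is used, so `g` need not be measurable; this matters because the
empirical eigenpairs are chosen arbitrarily for each `ω`. -/
theorem tendstoInMeasure_of_dist_le {Ω E F : Type*} [MeasurableSpace Ω] {P : Measure Ω}
    [PseudoMetricSpace E] [PseudoMetricSpace F] {f : ℕ → Ω → E} {a : E} {g : ℕ → Ω → F} {b : F}
    (hf : TendstoInMeasure P f atTop fun _ => a)
    (h : ∀ ε > 0, ∃ η > 0, ∀ n ω, dist (f n ω) a < η → dist (g n ω) b < ε) :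
    TendstoInMeasure P g atTop fun _ => b := by
  rw [tendstoInMeasure_iff_dist] at hf ⊢
  intro ε hε
  obtain ⟨η, hη, hle⟩ := h ε hε
  refine tendsto_of_tendsto_of_tendsto_of_le_of_le tendsto_const_nhds (hf η hη)
    (fun _ => zero_le) fun n => measure_mono fun ω hω => ?_
  by_contra hlt
  exact absurd (hle n ω (not_le.1 hlt)) (not_lt.2 hω)

theorem integral_sub_const_mul_sq (x y : L2I) (c : ℝ) :
    ∫ t : unitInterval, (x t - c * y t) ^ 2 = ‖x - c • y‖ ^ 2 := by
  rw [← real_inner_self_eq_norm_sq, L2.inner_def]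
  refine integral_congr_ae ?_
  filter_upwards [Lp.coeFn_sub x (c • y), Lp.coeFn_smul c y] with t h1 h2
  rw [h1, Pi.sub_apply, h2, Pi.smul_apply, smul_eq_mul, sq]
  rfl

theorem corollary1 {Ω : Type*} [MeasurableSpace Ω] (P : Measure Ω) [IsProbabilityMeasure P]
    (Y : ℕ → Ω → unitInterval → ℝ) (hY : IsIIDNoise P Y)
    (μ₁ μ₂ : unitInterval → ℝ) (hμ₁ : MemLp μ₁ 2 volume) (hμ₂ : MemLp μ₂ 2 volume)
    (θ : ℝ) (hθ : θ ∈ Set.Ioo (0 : ℝ) 1) (u : ℝ) (hu : u ∈ Set.Ioc (0 : ℝ) 1)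
    -- eigenvalues and eigenfunctions of the limit kernel
    (γ : ℕ → ℝ) (w : ℕ → L2I) (hγ : IsEigensystem (limitKernel P θ μ₁ μ₂ Y u) γ w)
    -- empirical eigenvalues and eigenfunctions
    (lamHat : ℕ → Ω → ℕ → ℝ) (vHat : ℕ → Ω → ℕ → L2I)
    (hHat : ∀ N ω, IsEigensystem
      (empCovKernel (fun i => changePointObs θ μ₁ μ₂ Y N i ω) N u) (lamHat N ω) (vHat N ω))
    (l : ℕ) :
    TendstoInMeasure P (fun N ω => lamHat N ω l) atTop (fun _ => γ l) ∧
    ((∀ m, m ≠ l → γ m ≠ γ l) →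
      TendstoInMeasure P
        (fun N ω => ∫ t : unitInterval,
          (vHat N ω l t - Real.sign (inner ℝ (w l) (vHat N ω l)) * w l t) ^ 2)
        atTop (fun _ => 0)) := by
  set A := hY.covOp + (θ * (1 - θ) * biasFactor θ u) •
    InnerProductSpace.rankOne ℝ (hμ₁.toLp μ₁ - hμ₂.toLp μ₂) (hμ₁.toLp μ₁ - hμ₂.toLp μ₂) with hA
  have hApos : A.IsPositive := by
    refine hY.isPositive_covOp.add
      ((InnerProductSpace.isPositive_rankOne_self _).smul_of_nonneg ?_)
    exact mul_nonneg (mul_nonneg hθ.1.le (by linarith [hθ.2])) (biasFactor_nonneg hθ.1 hθ.2)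
  have hS : IsSpectralSystem A γ w :=
    (isKernelOf_limitKernel hY hμ₁ hμ₂ θ u).isSpectralSystem hApos hγ
  have hT : ∀ (N : ℕ) ω, IsSpectralSystem (splitCovariance (changePointSeq (hμ₁.toLp μ₁) (hμ₂.toLp μ₂)
      (fun j => hY.toL2 j ω) ⌊(N : ℝ) * θ⌋₊) N ⌊(N : ℝ) * u⌋₊) (lamHat N ω) (vHat N ω) :=
    fun N ω => (isKernelOf_empCovKernel (fun i => coeFn_changePointSeq hY hμ₁ hμ₂ θ N i ω) N
      u).isSpectralSystem (isPositive_splitCovariance _ _ _) (hHat N ω)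
  have hconv := tendstoInMeasure_splitCovariance hY (hμ₁.toLp μ₁) (hμ₂.toLp μ₂) hθ hu
  refine ⟨tendstoInMeasure_of_dist_le hconv fun ε hε => ⟨ε, hε, fun N ω h => ?_⟩, fun hl => ?_⟩
  · rw [dist_eq_norm] at h
    rw [Real.dist_eq]
    exact ((hT N ω).abs_sub_le_norm_sub hS l).trans_lt h
  · obtain ⟨δ, hδ, hδl, hgap⟩ := hS.exists_gap hl
    -- The radius `η` solves `8 / δ ^ 2 * η ^ 2 = ε`.
    refine tendstoInMeasure_of_dist_le hconv fun ε hε =>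
      ⟨Real.sqrt (δ ^ 2 / 8 * ε), by positivity, fun N ω h => ?_⟩
    rw [dist_eq_norm, Real.lt_sqrt (norm_nonneg _)] at h
    rw [Real.dist_eq, sub_zero, integral_sub_const_mul_sq, abs_of_nonneg (by positivity)]
    refine ((hT N ω).norm_eigenvector_sub_sq_le hS hδ hδl hgap).trans_lt ?_
    calc _ < 8 / δ ^ 2 * (δ ^ 2 / 8 * ε) := by gcongr
      _ = ε := by field_simp
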